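/- Consider a finite distributionally robust Markov game: a finite set of agents $\mathcal N$, a nonempty finite state space $\mathcal S$, nonempty finite action sets $\mathcal A_i$ with $\mathcal A=\prod_{i}\mathcal A_i$, rewards $r_i:\mathcal S\times\mathcal A\to[0,1]$, and an $(s,a)$-rectangular uncertainty set of transition kernels $\mathcal P=\bigotimes_{(s,a)}\mathcal P_s^a$, where each $\mathcal P_s^a\subseteq\Delta(\mathcal S)$ is nonempty, compact and convex. Assume that for every deterministic joint stationary policy and every $\mathsf P\in\mathcal P$ the induced Markov chain on $\mathcal S$ is irreducible. For a stationary product policy $\pi=(\pi_i)_{i\in\mathcal N}$, $\pi_i:\mathcal S\to\Delta(\mathcal A_i)$, and $\gamma\in[0,1)$ let $$V^{\pi}_{\gamma,\mathcal P,i}(s)=\min_{\mathsf P\in\mathcal P}\mathbb E_{\pi,\mathsf P}\Big[\sum_{t\ge 0}\gamma^t r_i(S_t,a_t)\,\Big|\,S_0=s\Big],\qquad g^{\pi}_{\mathcal P,i}(s)=\min_{\mathsf P\in\mathcal P}\ \liminf_{n\to\infty}\mathbb E_{\pi,\mathsf P}\Big[\frac1n\sum_{t<n} r_i(S_t,a_t)\,\Big|\,S_0=s\Big].$$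 Call $\pi$ an $\epsilon$-Nash equilibrium of the $\gamma$-discounted game if $V^{\pi}_{\gamma,\mathcal P,i}(s)+\epsilon\ge V^{(\pi_{-i},\mu_i)}_{\gamma,\mathcal P,i}(s)$ for all $i\in\mathcal N$, $s\in\mathcal S$ and all stationary policies $\mu_i$ of agent $i$; define an $\epsilon$-Nash equilibrium under the average reward in the same way with $g$ in place of $V$. Define the robust diameter $$D=\max_{\mathsf P\in\mathcal P}\ \max_{s,s'\in\mathcal S}\ \min_{\pi}\ \mathbb E\big[T(s'\mid s,\pi,\mathsf P)\big],$$ where $\pi$ ranges over stationary product policies and $T(s'\mid s,\pi,\mathsf P)$ is the first time $t\ge 0$ at which state $s'$ is reached when $\pi$ is executed with kernel $\mathsf P$ from the initial state $s$. Then $D<\infty$, and for every $\epsilon$ with $0<\epsilon\le D$, every $\epsilon$-Nash equilibrium of the $\gamma$-discounted game with discount factor $\gamma=1-\epsilon/D$ is an $\mathcal O(\epsilon)$-Nash equilibrium under the average reward. That is, there is a constant $C>0$, depending only on the state space, the action sets and the uncertainty set $\mathcal P$ (not on $\epsilon$, the rewards, the policy, the agent or the initial state), such that every such equilibrium is a $C\epsilon$-Nash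 equilibrium under the average reward. -/

import Mathlib

open MeasureTheory ProbabilityTheory
open scoped ENNReal

namespace RobustMarkovGame

noncomputable section

variable {ι S : Type*} {A : ι → Type*}

/-- A joint action of all agents. -/
abbrev JointAction (A : ι → Type*) := ∀ i, A i

/-- What happens at one time step: the current state and the joint action taken there. -/
@[ext] structure Step (S : Type*) (A : ι → Type*) where
  state : S
  action : JointAction A

/-- States and actions are finite, so every set of steps is an event. -/
instance : MeasurableSpace (Step S A) := ⊤

instance : DiscreteMeasurableSpace (Step S A) := ⟨fun _ => trivial⟩

instance [Finite ι] [Finite S] [∀ i, Finite (A i)] : Finite (Step S A) :=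
  Finite.of_injective (fun x : Step S A => (x.state, x.action))
    (fun _ _ h => Step.ext (Prod.ext_iff.mp h).1 (Prod.ext_iff.mp h).2)

/-- A transition kernel: `P s a s'` is the probability to move to `s'` when the joint action `a`
is taken in state `s`. -/
abbrev TransitionKernel (S : Type*) [Fintype S] (A : ι → Type*) :=
  S → JointAction A → stdSimplex ℝ S

/-- A stationary (randomized) policy of one agent with action set `B`. -/
abbrev StationaryPolicy (S B : Type*) [Fintype B] := S → stdSimplex ℝ B

/-- A joint stationary product policy: one stationary policy for each agent. -/
abbrev JointPolicy (S : Type*) (A : ι → Type*) [∀ i, Fintype (A i)] :=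
  ∀ i, StationaryPolicy S (A i)

/-- The uncertainty set `⨂_{(s,a)} 𝒫_s^a`, given through its nonempty factors `𝒫_s^a ⊆ Δ(S)`. -/
structure UncertaintySet (S : Type*) [Fintype S] (A : ι → Type*) where
  factor : S → JointAction A → Set (S → ℝ)
  factor_subset : ∀ s a, factor s a ⊆ stdSimplex ℝ S
  factor_nonempty : ∀ s a, (factor s a).Nonempty

/-- The kernels in the uncertainty set: each `P s a` is chosen independently from `𝒫_s^a`. -/
def UncertaintySet.kernels [Fintype S] (U : UncertaintySet S A) : Set (TransitionKernel S A) :=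
  {P | ∀ s a, (P s a : S → ℝ) ∈ U.factor s a}

/-- The state transition matrix induced by a deterministic joint stationary policy `f`. -/
def inducedMatrix [Fintype S] (P : TransitionKernel S A) (f : ∀ i, S → A i) : Matrix S S ℝ :=
  Matrix.of fun s s' => P s (fun i => f i s) s'

/-- The uncertainty set is compact and convex, and every deterministic joint policy induces an
irreducible Markov chain under every kernel of the uncertainty set. -/
structure UncertaintySet.IsRegular [Fintype S] (U : UncertaintySet S A) : Prop where
  isCompact : ∀ s a, IsCompact (U.factor s a)
  convex : ∀ s a, Convex ℝ (U.factor s a)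
  irreducible : ∀ P ∈ U.kernels, ∀ f : ∀ i, S → A i, (inducedMatrix P f).IsIrreducible

section ActionProb

variable [Fintype ι] [∀ i, Fintype (A i)]

/-- The probability that the joint action `a` is taken in state `s`: the agents randomize
independently. -/
def actionProb (π : JointPolicy S A) (s : S) (a : JointAction A) : ℝ := ∏ i, π i s (a i)

lemma actionProb_nonneg (π : JointPolicy S A) (s : S) (a : JointAction A) :
    0 ≤ actionProb π s a :=
  Finset.prod_nonneg fun i _ => (π i s).2.1 (a i)

lemma sum_actionProb [DecidableEq ι] (π : JointPolicy S A) (s : S) :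
    ∑ a, actionProb π s a = 1 := by
  unfold actionProb
  rw [← Fintype.prod_sum (fun i (b : A i) => π i s b)]
  exact Finset.prod_eq_one fun i _ => (π i s).2.2

end ActionProb

section Dynamics

variable [Fintype ι] [DecidableEq ι] [Fintype S] [DecidableEq S] [∀ i, Fintype (A i)]

/-- The law of a step whose state is drawn from `w` and whose joint action is then drawn
from `π`. -/
def stepLaw (π : JointPolicy S A) (w : stdSimplex ℝ S) : Measure (Step S A) :=
  ∑ s, ∑ a, ENNReal.ofReal (w s * actionProb π s a) • Measure.dirac ⟨s, a⟩

instance (π : JointPolicy S A) (w : stdSimplex ℝ S) : IsProbabilityMeasure (stepLaw π w) := by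
  have hw : ∀ s, 0 ≤ w s := w.2.1
  constructor
  simp only [stepLaw, Measure.coe_finsetSum, Finset.sum_apply, Measure.smul_apply, measure_univ,
    smul_eq_mul, mul_one]
  simp_rw [← ENNReal.ofReal_sum_of_nonneg fun a (_ : a ∈ Finset.univ) =>
    mul_nonneg (hw _) (actionProb_nonneg π _ a), ← Finset.mul_sum, sum_actionProb, mul_one]
  rw [← ENNReal.ofReal_sum_of_nonneg fun s _ => hw s]
  have h1 : ∑ s, w s = 1 := w.2.2
  rw [h1, ENNReal.ofReal_one]

/-- The one-step kernel of the state-action process: from `(s, a)`, the next state is drawn from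
`P s a` and the next joint action from `π`. -/
def stepKernel (π : JointPolicy S A) (P : TransitionKernel S A) : Kernel (Step S A) (Step S A) :=
  ⟨fun x => stepLaw π (P x.state x.action), Measurable.of_discrete⟩

instance (π : JointPolicy S A) (P : TransitionKernel S A) : IsMarkovKernel (stepKernel π P) :=
  ⟨fun x => inferInstanceAs (IsProbabilityMeasure (stepLaw π (P x.state x.action)))⟩

/-- The law `ℙ_{π,P}( · | S₀ = s)` of the infinite trajectory `(S₀, a₀), (S₁, a₁), …`. -/
def trajectoryLaw (π : JointPolicy S A) (P : TransitionKernel S A) (s : S) :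
    Measure (ℕ → Step S A) :=
  Kernel.trajMeasure (X := fun _ => Step S A) (stepLaw π (stdSimplex.vertex s))
    (fun n => (stepKernel π P).comap (fun h => h ⟨n, Finset.mem_Iic.2 le_rfl⟩)
      (measurable_pi_apply _))

/-- The discounted value `V^π_P(s) = 𝔼_{π,P}[∑ γ^t r_t | S₀ = s]`. -/
def discountedValue (γ : ℝ) (r : S → JointAction A → ℝ) (π : JointPolicy S A)
    (P : TransitionKernel S A) (s : S) : ℝ :=
  ∫ ω, ∑' t, γ ^ t * r (ω t).state (ω t).action ∂(trajectoryLaw π P s)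

/-- The average reward `g^π_P(s) = liminf_n 𝔼_{π,P}[(1/n) ∑_{t<n} r_t | S₀ = s]`. -/
def averageReward (r : S → JointAction A → ℝ) (π : JointPolicy S A)
    (P : TransitionKernel S A) (s : S) : ℝ :=
  Filter.liminf (fun n : ℕ => ∫ ω, (1 / (n : ℝ)) *
    ∑ t ∈ Finset.range n, r (ω t).state (ω t).action ∂(trajectoryLaw π P s)) Filter.atTop

/-- The first time `T(s')` at which a trajectory is in state `s'` (`⊤` if this never happens);
it is `0` for a trajectory that starts in `s'`. -/
def hittingTime (s' : S) (ω : ℕ → Step S A) : ℝ≥0∞ :=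
  ⨅ (t : ℕ) (_ : (ω t).state = s'), (t : ℝ≥0∞)

namespace UncertaintySet

variable (U : UncertaintySet S A)

/-- The worst-case discounted value over the uncertainty set. -/
def robustDiscountedValue (γ : ℝ) (r : S → JointAction A → ℝ) (π : JointPolicy S A) (s : S) : ℝ :=
  ⨅ P : U.kernels, discountedValue γ r π P.1 s

/-- The worst-case average reward over the uncertainty set. -/
def robustAverageReward (r : S → JointAction A → ℝ) (π : JointPolicy S A) (s : S) : ℝ :=
  ⨅ P : U.kernels, averageReward r π P.1 s

/-- The robust diameter `D = max_P max_{s,s'} min_π 𝔼[T(s' | s, π, P)]`. -/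
def robustDiameter : ℝ≥0∞ :=
  ⨆ P : U.kernels, ⨆ s : S, ⨆ s' : S, ⨅ π : JointPolicy S A,
    ∫⁻ ω, hittingTime s' ω ∂(trajectoryLaw π P.1 s)

/-- `π` is an `ε`-Nash equilibrium of the `γ`-discounted robust game with rewards `r`. -/
def IsDiscountedNash (r : ι → S → JointAction A → ℝ) (γ ε : ℝ) (π : JointPolicy S A) : Prop :=
  ∀ (i : ι) (μ : StationaryPolicy S (A i)) (s : S),
    U.robustDiscountedValue γ (r i) (Function.update π i μ) s ≤
      U.robustDiscountedValue γ (r i) π s + ε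

/-- `π` is an `ε`-Nash equilibrium of the average-reward robust game with rewards `r`. -/
def IsAverageNash (r : ι → S → JointAction A → ℝ) (ε : ℝ) (π : JointPolicy S A) : Prop :=
  ∀ (i : ι) (μ : StationaryPolicy S (A i)) (s : S),
    U.robustAverageReward (r i) (Function.update π i μ) s ≤
      U.robustAverageReward (r i) π s + ε

end UncertaintySet

end Dynamics

end

end RobustMarkovGame

/-! The normalized value `(1 - γ) V` approximates the average reward with an error of order `1 - γ`,
uniformly in the policy, the kernel, the rewards and the initial state; an equilibrium for one
criterion is then an approximate equilibrium for the other.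

Uniformity comes from compactness. A randomized policy puts positive mass on some joint action in
each state, so irreducibility under deterministic policies makes every state reachable under it.
Entries of matrix powers are continuous in kernel and policy, which range over compact sets, so one
constant `C` serves all the chains (`exists_isHittingBound`).

A maximum argument (`le_sq_of_isHittingBound`) turns `C` into the bound `C * C` on any `u ≥ 0` that
vanishes at some state and satisfies `u ≤ 1 + M u`. Applied to `max V - V`, it bounds the span of
`V` independently of `γ`; applied to truncated expected hitting times, it gives `D < ∞`. Telescoping
the Bellman equation expresses time averages of rewards through `V`, and the span bound yields the
error `(1 - γ) * (C * C)`. This survives the infimum over kernels. With `1 - γ = ε / D ≤ 1`,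
comparing a deviation with `π` costs this error twice, plus at most `ε`. -/

namespace RobustMarkovGame

noncomputable section

/-! ### Trajectory expectations as powers of transition matrices. -/

section Occupation

variable {ι S : Type*} {A : ι → Type*}
variable [Fintype ι] [DecidableEq ι] [Fintype S] [∀ i, Fintype (A i)]

/-- The state transition matrix induced by a joint policy. -/
def transitionMatrix (π : JointPolicy S A) (P : TransitionKernel S A) : Matrix S S ℝ :=
  Matrix.of fun s s' => ∑ a, actionProb π s a * P s a s'

/-- The mean of `f` over a step from `s`, the action being drawn from `π`. -/
def policyMean (π : JointPolicy S A) (f : Step S A → ℝ) (s : S) : ℝ :=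
  ∑ a, actionProb π s a * f ⟨s, a⟩

lemma transitionMatrix_nonneg (π : JointPolicy S A) (P : TransitionKernel S A) (s s' : S) :
    0 ≤ transitionMatrix π P s s' :=
  Finset.sum_nonneg fun a _ => mul_nonneg (actionProb_nonneg π s a) ((P s a).2.1 s')

lemma sum_transitionMatrix (π : JointPolicy S A) (P : TransitionKernel S A) (s : S) :
    ∑ s', transitionMatrix π P s s' = 1 := by
  simp only [transitionMatrix, Matrix.of_apply]
  rw [Finset.sum_comm, ← sum_actionProb π s]
  refine Finset.sum_congr rfl fun a _ => ?_
  have h : ∑ s', P s a s' = 1 := (P s a).2.2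
  rw [← Finset.mul_sum, h, mul_one]

lemma integral_stepLaw (π : JointPolicy S A) (w : stdSimplex ℝ S) (f : Step S A → ℝ) :
    ∫ x, f x ∂(stepLaw π w) = ∑ s, w s * policyMean π f s := by
  have hw : ∀ s, 0 ≤ w s := w.2.1
  have hint : ∀ s a, Integrable f
      (ENNReal.ofReal (w s * actionProb π s a) • Measure.dirac (⟨s, a⟩ : Step S A)) :=
    fun s a => Integrable.of_finite.smul_measure ENNReal.ofReal_ne_top
  unfold stepLaw
  rw [integral_finsetSum_measure fun s _ => integrable_finsetSum_measure.2 fun a _ => hint s a]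
  refine Finset.sum_congr rfl fun s _ => ?_
  rw [integral_finsetSum_measure fun a _ => hint s a, policyMean, Finset.mul_sum]
  refine Finset.sum_congr rfl fun a _ => ?_
  rw [integral_smul_measure, integral_dirac,
    ENNReal.toReal_ofReal (mul_nonneg (hw s) (actionProb_nonneg π s a)), smul_eq_mul, mul_assoc]

variable [DecidableEq S]

lemma transitionMatrix_mem_rowStochastic (π : JointPolicy S A) (P : TransitionKernel S A) :
    transitionMatrix π P ∈ Matrix.rowStochastic ℝ S :=
  Matrix.mem_rowStochastic_iff_sum.2 ⟨transitionMatrix_nonneg π P, sum_transitionMatrix π P⟩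

instance (π : JointPolicy S A) (P : TransitionKernel S A) (s : S) :
    IsProbabilityMeasure (trajectoryLaw π P s) := by
  unfold trajectoryLaw; infer_instance

lemma integrable_eval_trajectoryLaw (π : JointPolicy S A) (P : TransitionKernel S A) (s : S)
    (n : ℕ) (G : (Finset.Iic n → Step S A) → ℝ) :
    Integrable (fun ω => G (Preorder.frestrictLe n ω)) (trajectoryLaw π P s) :=
  (Integrable.of_finite (μ := (trajectoryLaw π P s).map
    (Preorder.frestrictLe (π := fun _ => Step S A) n)) (f := G)).comp_measurable
      (by fun_prop)

lemma map_eval_zero_trajectoryLaw (π : JointPolicy S A) (P : TransitionKernel S A) (s : S) :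
    (trajectoryLaw π P s).map (fun ω => ω 0) = stepLaw π (stdSimplex.vertex s) := by
  have h0 : (fun ω : ℕ → Step S A => ω 0) =
      (fun h : Finset.Iic 0 → Step S A => h ⟨0, Finset.mem_Iic.2 le_rfl⟩) ∘
        Preorder.frestrictLe (π := fun _ => Step S A) 0 := rfl
  rw [h0, ← Measure.map_map (by fun_prop) (by fun_prop), trajectoryLaw, Kernel.trajMeasure,
    Measure.map_comp _ _ (by fun_prop), Kernel.traj_map_frestrictLe, Kernel.partialTraj_self,
    Measure.id_comp, Measure.map_map (by fun_prop) (by fun_prop)]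
  exact Measure.map_id

lemma integral_trajectoryLaw_zero (π : JointPolicy S A) (P : TransitionKernel S A) (s : S)
    (f : Step S A → ℝ) :
    ∫ ω, f (ω 0) ∂(trajectoryLaw π P s) = policyMean π f s := by
  have h := integral_stepLaw π (stdSimplex.vertex s) f
  rw [← map_eval_zero_trajectoryLaw π P, integral_map
    (measurable_pi_apply 0).aemeasurable Measurable.of_discrete.aestronglyMeasurable] at h
  rw [h]
  simp [stdSimplex.vertex_coe, Pi.single_apply]

/-- Markov property: given the history up to time `n`, on which `G` depends, the next step follows
the one-step kernel. -/
lemma integral_trajectoryLaw_succ (π : JointPolicy S A) (P : TransitionKernel S A) (s : S)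
    (n : ℕ) (G : (Finset.Iic n → Step S A) → ℝ) (f : Step S A → ℝ) :
    ∫ ω, G (Preorder.frestrictLe n ω) * f (ω (n + 1)) ∂(trajectoryLaw π P s) =
      ∫ ω, G (Preorder.frestrictLe n ω) *
        ∑ s', P (ω n).state (ω n).action s' * policyMean π f s' ∂(trajectoryLaw π P s) := by
  have h := Kernel.map_frestrictLe_trajMeasure_compProd_eq_map_trajMeasure
    (X := fun _ => Step S A) (μ₀ := stepLaw π (stdSimplex.vertex s))
    (κ := fun n => (stepKernel π P).comap (fun h => h ⟨n, Finset.mem_Iic.2 le_rfl⟩)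
      (measurable_pi_apply _)) (a := n)
  have hL : ∫ ω, G (Preorder.frestrictLe n ω) * f (ω (n + 1)) ∂(trajectoryLaw π P s) =
      ∫ x, G x.1 * f x.2 ∂((trajectoryLaw π P s).map
        (fun x => (Preorder.frestrictLe (π := fun _ => Step S A) n x, x (n + 1)))) := by
    rw [integral_map (by fun_prop) Measurable.of_discrete.aestronglyMeasurable]
  rw [hL]
  unfold trajectoryLaw
  rw [← h, Measure.integral_compProd Integrable.of_finite,
    integral_map (by fun_prop) Measurable.of_discrete.aestronglyMeasurable]
  refine integral_congr_ae (Filter.Eventually.of_forall fun ω => ?_)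
  simp only [integral_const_mul]
  congr 1
  exact integral_stepLaw π _ f

/-- Multiplicative functionals of a trajectory are computed by powers of a weighted transition
matrix. -/
lemma integral_prod_mul_trajectoryLaw (π : JointPolicy S A) (P : TransitionKernel S A) (s : S)
    (c : S → ℝ) (n : ℕ) (f : Step S A → ℝ) :
    ∫ ω, (∏ i ∈ Finset.range (n + 1), c (ω i).state) * f (ω n) ∂(trajectoryLaw π P s) =
      ((Matrix.diagonal c * transitionMatrix π P) ^ n).mulVec (c * policyMean π f) s := by
  induction n generalizing f with
  | zero =>
    have := integral_trajectoryLaw_zero π P s (fun x => c x.state * f x)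
    simp only [zero_add, Finset.range_one, Finset.prod_singleton, pow_zero, Matrix.one_mulVec,
      Pi.mul_apply, this, policyMean, Finset.mul_sum]
    exact Finset.sum_congr rfl fun a _ => by ring
  | succ n ih =>
    have h := integral_trajectoryLaw_succ π P s n
      (fun h => ∏ i ∈ (Finset.range (n + 1)).attach,
        c (h ⟨i.1, Finset.mem_Iic.2 (Nat.lt_succ_iff.1 (Finset.mem_range.1 i.2))⟩).state)
      (fun x => c x.state * f x)
    have hprod : ∀ ω : ℕ → Step S A, (∏ i ∈ (Finset.range (n + 1)).attach,
        c (Preorder.frestrictLe (π := fun _ => Step S A) n ω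
          ⟨i.1, Finset.mem_Iic.2 (Nat.lt_succ_iff.1 (Finset.mem_range.1 i.2))⟩).state) =
        ∏ i ∈ Finset.range (n + 1), c (ω i).state := fun ω =>
      Finset.prod_attach (Finset.range (n + 1)) (fun i => c (ω i).state)
    simp only [hprod] at h
    simp_rw [Finset.prod_range_succ _ (n + 1), mul_assoc]
    rw [h, ih fun x => ∑ s', P x.state x.action s' * policyMean π (fun x => c x.state * f x) s',
      pow_succ, ← Matrix.mulVec_mulVec]
    congr 2
    ext s
    have hc : policyMean π (fun x => c x.state * f x) = c * policyMean π f := by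
      ext s
      simp only [policyMean, Pi.mul_apply, Finset.mul_sum]
      exact Finset.sum_congr rfl fun a _ => by ring
    rw [hc, ← Matrix.mulVec_mulVec, Matrix.mulVec_diagonal, Pi.mul_apply]
    congr 1
    simp only [policyMean, Matrix.mulVec, dotProduct, transitionMatrix, Matrix.of_apply,
      Finset.mul_sum, Finset.sum_mul]
    rw [Finset.sum_comm]
    exact Finset.sum_congr rfl fun a _ => Finset.sum_congr rfl fun a _=>
      (mul_assoc _ _ _).symm

end Occupation

/-! ### Span of the discounted value and time averages, for a single chain. -/

section StochasticMatrix

open Filter Topology Matrix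

variable {S : Type*} [Fintype S] [DecidableEq S] {M : Matrix S S ℝ}

lemma mulVec_le_of_le (hM : M ∈ rowStochastic ℝ S) {u : S → ℝ} {K : ℝ} (hu : ∀ s, u s ≤ K)
    (s : S) : (M *ᵥ u) s ≤ K := by
  calc (M *ᵥ u) s ≤ ∑ s', M s s' * K :=
        Finset.sum_le_sum fun s' _ => mul_le_mul_of_nonneg_left (hu s') (hM.1 s s')
    _ = K := by rw [← Finset.sum_mul, sum_row_of_mem_rowStochastic hM, one_mul]

lemma le_mulVec_of_le (hM : M ∈ rowStochastic ℝ S) {u : S → ℝ} {K : ℝ} (hu : ∀ s, K ≤ u s)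
    (s : S) : K ≤ (M *ᵥ u) s := by
  calc K = ∑ s', M s s' * K := by
        rw [← Finset.sum_mul, sum_row_of_mem_rowStochastic hM, one_mul]
    _ ≤ (M *ᵥ u) s :=
        Finset.sum_le_sum fun s' _ => mul_le_mul_of_nonneg_left (hu s') (hM.1 s s')

/-- From every state, the chain with transition matrix `M` is in any given state with probability
at least `1 / C` after some number `k ≤ C` of steps. -/
def IsHittingBound (M : Matrix S S ℝ) (C : ℝ) : Prop :=
  ∀ s x, ∃ k : ℕ, (k : ℝ) ≤ C ∧ 1 ≤ C * (M ^ k) s x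

lemma le_add_pow_mulVec (hM : M ∈ rowStochastic ℝ S) {u : S → ℝ}
    (h : ∀ s, u s ≤ 1 + (M *ᵥ u) s) (k : ℕ) (s : S) : u s ≤ k + (M ^ k *ᵥ u) s := by
  induction k with
  | zero => simp
  | succ k ih =>
    have hk := pow_mem hM k
    have h1 : 0 ≤ (M ^ k *ᵥ (1 + M *ᵥ u - u)) s :=
      le_mulVec_of_le hk (fun s => sub_nonneg.2 (h s)) s
    rw [mulVec_sub, mulVec_add, mulVec_mulVec, ← pow_succ, hk.2] at h1
    simp only [Pi.sub_apply, Pi.add_apply, Pi.one_apply] at h1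
    push_cast
    linarith

/-- Let `u` be maximal at `y`, and let `p ≥ 1 / C` be the probability of being in `x` after `k ≤ C`
steps from `y`. Since `u x = 0`, iterating the hypothesis gives `u y ≤ k + (1 - p) * u y`, so `p * u
y ≤ C`. -/
lemma le_sq_of_isHittingBound (hM : M ∈ rowStochastic ℝ S) {C : ℝ} (hC : IsHittingBound M C)
    (hC0 : 0 < C) {u : S → ℝ} {x : S} (hx : u x = 0) (h0 : ∀ s, 0 ≤ u s)
    (h : ∀ s, u s ≤ 1 + (M *ᵥ u) s) (s : S) : u s ≤ C * C := by
  have : Nonempty S := ⟨x⟩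
  obtain ⟨y, hy⟩ := Finite.exists_max u
  refine (hy s).trans ?_
  obtain ⟨k, hk, hkx⟩ := hC y x
  have hMk := pow_mem hM k
  have h1 : (M ^ k *ᵥ u) y ≤ u y - (M ^ k) y x * u y := by
    -- Raising `u` at `x` from `0` to the maximum `u y` keeps it below `u y` everywhere.
    have h2 : (M ^ k *ᵥ u) y + (M ^ k) y x * u y = (M ^ k *ᵥ (u + Pi.single x (u y))) y := by
      rw [mulVec_add]; simp [mul_comm]
    have h3 := mulVec_le_of_le hMk (u := u + Pi.single x (u y)) (K := u y) (fun s => by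
      by_cases hs : s = x
      · subst hs; simp [hx]
      · simpa [hs] using hy s) y
    linarith
  have h4 := le_add_pow_mulVec hM h k y
  have h5 : (M ^ k) y x * u y ≤ C := by linarith
  calc u y ≤ C * (M ^ k) y x * u y := le_mul_of_one_le_left (h0 y) hkx
    _ = C * ((M ^ k) y x * u y) := mul_assoc _ _ _
    _ ≤ C * C := mul_le_mul_of_nonneg_left h5 hC0.le

variable {γ : ℝ} {ρ V : S → ℝ}

lemma sub_le_of_isHittingBound (hM : M ∈ rowStochastic ℝ S) {C : ℝ} (hC : IsHittingBound M C)
    (hC0 : 0 < C) (hγ : γ ∈ Set.Ico (0 : ℝ) 1) (hρ : ∀ s, ρ s ∈ Set.Icc (0 : ℝ) 1)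
    (hV : V = ρ + γ • (M *ᵥ V)) (s s' : S) : V s - V s' ≤ C * C := by
  have : Nonempty S := ⟨s⟩
  have hV' : ∀ s, V s = ρ s + γ * (M *ᵥ V) s := fun s => congrFun hV s
  obtain ⟨x, hx⟩ := Finite.exists_max V
  have hmax := mulVec_le_of_le hM hx
  -- This makes `(1 - γ) * (M *ᵥ V)` at most `1`, which is what `max V - V` needs to satisfy `u ≤ 1
  -- + M u` with no factor `γ`.
  have hbound : (1 - γ) * V x ≤ 1 := by
    nlinarith [hV' x, mul_le_mul_of_nonneg_left (hmax x) hγ.1, (hρ x).2]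
  have key := le_sq_of_isHittingBound hM hC hC0 (u := fun s => V x - V s) (x := x) (sub_self _)
    (fun s => sub_nonneg.2 (hx s)) (fun s => by
      have h1 : (M *ᵥ fun s => V x - V s) s = V x - (M *ᵥ V) s := by
        have : (fun s => V x - V s) = V x • (1 : S → ℝ) - V := by ext; simp
        rw [this, mulVec_sub, mulVec_smul, hM.2]; simp
      rw [h1]
      nlinarith [hV' s, mul_le_mul_of_nonneg_left (hmax s) (sub_nonneg.2 hγ.2.le), (hρ s).1]) s'
  linarith [hx s]

/-- Substituting `ρ = V - γ M V` makes the sum telescope up to the factor `γ`. -/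
lemma sum_pow_mulVec (hV : V = ρ + γ • (M *ᵥ V)) (n : ℕ) (s : S) :
    ∑ t ∈ Finset.range n, (M ^ t *ᵥ ρ) s =
      (1 - γ) * ∑ t ∈ Finset.range n, (M ^ t *ᵥ V) s + γ * (V s - (M ^ n *ᵥ V) s) := by
  induction n with
  | zero => simp
  | succ n ih =>
    have h : (M ^ n *ᵥ V) s = (M ^ n *ᵥ ρ) s + γ * (M ^ (n + 1) *ᵥ V) s := by
      conv_lhs => rw [hV]
      rw [mulVec_add, mulVec_smul, mulVec_mulVec, ← pow_succ]; rfl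
    rw [Finset.sum_range_succ, Finset.sum_range_succ, ih]
    linear_combination -h

lemma abs_liminf_sub_le {b : ℕ → ℝ} {c d K : ℝ}
    (h : ∀ n : ℕ, 0 < n → |b n - c| ≤ d + K / n) : |liminf b atTop - c| ≤ d := by
  have hlim : Tendsto (fun n : ℕ => K / n) atTop (𝓝 0) := tendsto_const_div_atTop_nhds_zero_nat K
  have hlo : Tendsto (fun n : ℕ => c - (d + K / n)) atTop (𝓝 (c - (d + 0))) :=
    tendsto_const_nhds.sub (tendsto_const_nhds.add hlim)
  have hhi : Tendsto (fun n : ℕ => c + (d + K / n)) atTop (𝓝 (c + (d + 0))) :=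
    tendsto_const_nhds.add (tendsto_const_nhds.add hlim)
  have hb1 : (fun n : ℕ => c - (d + K / n)) ≤ᶠ[atTop] b := by
    filter_upwards [eventually_gt_atTop 0] with n hn
    linarith [(abs_le.1 (h n hn)).1]
  have hb2 : b ≤ᶠ[atTop] (fun n : ℕ => c + (d + K / n)) := by
    filter_upwards [eventually_gt_atTop 0] with n hn
    linarith [(abs_le.1 (h n hn)).2]
  have hlow : IsBoundedUnder (· ≥ ·) atTop b := hlo.isBoundedUnder_ge.mono_ge hb1
  have hup : IsBoundedUnder (· ≤ ·) atTop b := hhi.isBoundedUnder_le.mono_le hb2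
  have h1 := liminf_le_liminf hb1 hlo.isBoundedUnder_ge hup.isCoboundedUnder_ge
  have h2 := liminf_le_liminf hb2 hlow hhi.isBoundedUnder_le.isCoboundedUnder_ge
  rw [hlo.liminf_eq] at h1
  rw [hhi.liminf_eq] at h2
  rw [abs_le]; constructor <;> linarith

/-- The long-run average of the rewards `ρ` is close to the normalized discounted value. -/
lemma abs_liminf_average_sub_le (hM : M ∈ rowStochastic ℝ S) {C : ℝ} (hC : IsHittingBound M C)
    (hC0 : 0 < C) (hγ : γ ∈ Set.Ico (0 : ℝ) 1) (hρ : ∀ s, ρ s ∈ Set.Icc (0 : ℝ) 1)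
    (hV : V = ρ + γ • (M *ᵥ V)) (s : S) :
    |liminf (fun n : ℕ => 1 / (n : ℝ) * ∑ t ∈ Finset.range n, (M ^ t *ᵥ ρ) s) atTop
      - (1 - γ) * V s| ≤ (1 - γ) * (C * C) := by
  have hspan := sub_le_of_isHittingBound hM hC hC0 hγ hρ hV
  have hpow : ∀ t, |(M ^ t *ᵥ V) s - V s| ≤ C * C := fun t => by
    have h1 := mulVec_le_of_le (pow_mem hM t) (u := V) (K := V s + C * C)
      (fun s' => by linarith [hspan s' s]) s
    have h2 := le_mulVec_of_le (pow_mem hM t) (u := V) (K := V s - C * C)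
      (fun s' => by linarith [hspan s s']) s
    rw [abs_le]; constructor <;> linarith
  refine abs_liminf_sub_le (K := C * C) fun n hn => ?_
  have hn' : (0 : ℝ) < n := Nat.cast_pos.2 hn
  have hsum : |∑ t ∈ Finset.range n, ((M ^ t *ᵥ V) s - V s)| ≤ n * (C * C) := by
    refine (Finset.abs_sum_le_sum_abs _ _).trans ((Finset.sum_le_sum fun t _ => hpow t).trans ?_)
    simp
  rw [Finset.sum_sub_distrib, Finset.sum_const, Finset.card_range, nsmul_eq_mul] at hsum
  -- The first part averages differences bounded by the span of `V`; the second is a boundary term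
  -- that vanishes as `n` grows.
  have hdecomp : 1 / (n : ℝ) * ∑ t ∈ Finset.range n, (M ^ t *ᵥ ρ) s - (1 - γ) * V s =
      ((1 - γ) * (∑ t ∈ Finset.range n, (M ^ t *ᵥ V) s - n * V s) +
        γ * (V s - (M ^ n *ᵥ V) s)) / n := by
    rw [sum_pow_mulVec hV]
    field_simp
    ring
  have hbound : (1 - γ) * (C * C) + C * C / n = ((1 - γ) * (n * (C * C)) + 1 * (C * C)) / n := by
    field_simp
  rw [hdecomp, hbound, abs_div, abs_of_pos hn']
  refine div_le_div_of_nonneg_right ((abs_add_le _ _).trans ?_) hn'.le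
  rw [abs_mul, abs_mul, abs_of_nonneg (sub_nonneg.2 hγ.2.le), abs_of_nonneg hγ.1, abs_sub_comm (V s)]
  exact add_le_add (mul_le_mul_of_nonneg_left hsum (sub_nonneg.2 hγ.2.le))
    (mul_le_mul hγ.2.le (hpow n) (abs_nonneg _) zero_le_one)

end StochasticMatrix

/-! ### Uniform reachability by compactness. -/

section UniformHitting

open Filter Topology

lemma pow_apply_pos_of_apply_pos {S : Type*} [Fintype S] [DecidableEq S] {A B : Matrix S S ℝ}
    (hA : ∀ i j, 0 ≤ A i j) (hB : B ∈ Matrix.rowStochastic ℝ S)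
    (h : ∀ i j, 0 < A i j → 0 < B i j) (k : ℕ) (i j : S) (hij : 0 < (A ^ k) i j) :
    0 < (B ^ k) i j := by
  induction k generalizing i with
  | zero => simpa using hij
  | succ k ih =>
    rw [pow_succ', Matrix.mul_apply] at hij ⊢
    obtain ⟨l, -, hl⟩ := Finset.exists_lt_of_sum_lt (s := Finset.univ)
      (f := fun _ : S => (0 : ℝ)) (by simpa using hij)
    have hl1 : 0 < A i l := (hA i l).lt_of_ne fun h0 => by simp [← h0] at hl
    exact Finset.sum_pos' (fun l _ => mul_nonneg (hB.1 i l) ((pow_mem hB k).1 l j))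
      ⟨l, Finset.mem_univ l,
        mul_pos (h i l hl1) (ih l ((pos_iff_pos_of_mul_pos hl).1 hl1))⟩

lemma isCompact_kernels {ι S : Type*} {A : ι → Type*} [Fintype S] {U : UncertaintySet S A}
    (hU : U.IsRegular) : IsCompact U.kernels := by
  refine IsClosed.isCompact ?_
  simp only [UncertaintySet.kernels, Set.ofPred_forall]
  exact isClosed_iInter fun s => isClosed_iInter fun a =>
    (hU.isCompact s a).isClosed.preimage (by fun_prop)

variable {ι S : Type*} {A : ι → Type*}

variable [Fintype ι] [DecidableEq ι] [∀ i, Fintype (A i)]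

lemma exists_actionProb_pos (π : JointPolicy S A) (s : S) : ∃ a, 0 < actionProb π s a := by
  obtain ⟨a, -, ha⟩ := Finset.exists_lt_of_sum_lt (s := Finset.univ)
    (f := fun _ : JointAction A => (0 : ℝ)) (g := actionProb π s) (by simp [sum_actionProb])
  exact ⟨a, ha⟩

variable [Fintype S] [DecidableEq S] {U : UncertaintySet S A}

/-- Selecting in each state a joint action of positive probability gives a deterministic policy;
every transition possible under it is possible under `π`, so its irreducibility transfers. -/
lemma exists_pow_transitionMatrix_pos (hU : U.IsRegular) {P : TransitionKernel S A}
    (hP : P ∈ U.kernels) (π : JointPolicy S A) (s x : S) :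
    ∃ k, 0 < (transitionMatrix π P ^ k) s x := by
  choose F hF using exists_actionProb_pos π
  have hnn : ∀ s s', 0 ≤ inducedMatrix P (fun i s => F s i) s s' := fun s s' =>
    (P s (F s)).2.1 s'
  obtain ⟨k, -, hk⟩ := (Matrix.isIrreducible_iff_exists_pow_pos hnn).1
    (hU.irreducible P hP fun i s => F s i) s x
  exact ⟨k, pow_apply_pos_of_apply_pos hnn (transitionMatrix_mem_rowStochastic π P)
    (fun s s' h => Finset.sum_pos' (fun a _ => mul_nonneg (actionProb_nonneg π s a) ((P s a).2.1 s'))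
      ⟨F s, Finset.mem_univ _, mul_pos (hF s) h⟩) k s x hk⟩

lemma continuous_pow_transitionMatrix (k : ℕ) (s x : S) :
    Continuous fun p : TransitionKernel S A × JointPolicy S A =>
      (transitionMatrix p.2 p.1 ^ k) s x := by
  have h : Continuous fun p : TransitionKernel S A × JointPolicy S A =>
      transitionMatrix p.2 p.1 := by
    refine continuous_matrix fun s s' => continuous_finsetSum _ fun a _ => Continuous.mul ?_ ?_
    · refine continuous_finsetProd _ fun i _ => ?_
      exact (continuous_apply (a i)).comp (continuous_subtype_val.comp
        ((continuous_apply s).comp ((continuous_apply i).comp continuous_snd)))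
    · exact (continuous_apply s').comp (continuous_subtype_val.comp
        ((continuous_apply a).comp ((continuous_apply s).comp continuous_fst)))
  exact (h.pow k).matrix_elem s x

/-- Quantifying over all `C' ≥ C` makes the property stable under unions, as compactness induction
requires. Locally, one exponent `k` works because the entry stays above half its value. -/
lemma exists_hittingBound_apply (hU : U.IsRegular) (s x : S) :
    ∃ C : ℝ, ∀ C' ≥ C, ∀ p ∈ U.kernels ×ˢ (Set.univ : Set (JointPolicy S A)),
      ∃ k : ℕ, (k : ℝ) ≤ C' ∧ 1 ≤ C' * (transitionMatrix p.2 p.1 ^ k) s x := by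
  refine ((isCompact_kernels hU).prod isCompact_univ).induction_on
    (p := fun t => ∃ C : ℝ, ∀ C' ≥ C, ∀ p ∈ t,
      ∃ k : ℕ, (k : ℝ) ≤ C' ∧ 1 ≤ C' * (transitionMatrix p.2 p.1 ^ k) s x) ⟨0, by simp⟩ ?_ ?_ ?_
  · rintro t t' htt ⟨C, hC⟩
    exact ⟨C, fun C' hC' p hp => hC C' hC' p (htt hp)⟩
  · rintro t t' ⟨C₁, h₁⟩ ⟨C₂, h₂⟩
    refine ⟨max C₁ C₂, fun C' hC' p hp => hp.elim (h₁ C' ?_ p) (h₂ C' ?_ p)⟩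
    exacts [(le_max_left _ _).trans hC', (le_max_right _ _).trans hC']
  · rintro ⟨P, π⟩ ⟨hP, -⟩
    obtain ⟨k, hk⟩ := exists_pow_transitionMatrix_pos hU hP π s x
    set m := (transitionMatrix π P ^ k) s x with hm
    have hnhds := (continuous_pow_transitionMatrix k s x).continuousAt.eventually
      (lt_mem_nhds (show m / 2 < (transitionMatrix π P ^ k) s x by linarith) :
        ∀ᶠ y in 𝓝 ((transitionMatrix (P, π).2 (P, π).1 ^ k) s x), m / 2 < y)
    refine ⟨_, mem_nhdsWithin_of_mem_nhds hnhds, max k (2 / m), fun C' hC' p hp => ⟨k,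
      (le_max_left _ _).trans hC', ?_⟩⟩
    have h1 : 2 / m ≤ C' := (le_max_right _ _).trans hC'
    have hp' : m / 2 < (transitionMatrix p.2 p.1 ^ k) s x := hp
    calc (1 : ℝ) = 2 / m * (m / 2) := by field_simp
      _ ≤ C' * (transitionMatrix p.2 p.1 ^ k) s x :=
        mul_le_mul h1 hp'.le (by positivity) (le_trans (by positivity) h1)

/-- All the chains induced by a joint policy and a kernel of a regular uncertainty set share a
bound on their hitting times. -/
lemma exists_isHittingBound (hU : U.IsRegular) :
    ∃ C : ℝ, 0 < C ∧ ∀ P ∈ U.kernels, ∀ π : JointPolicy S A,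
      IsHittingBound (transitionMatrix π P) C := by
  choose C hC using exists_hittingBound_apply hU
  obtain ⟨B, hB⟩ := (Set.finite_range fun q : S × S => C q.1 q.2).bddAbove
  refine ⟨max B 1, by positivity, fun P hP π s x => ?_⟩
  exact hC s x (max B 1) ((hB ⟨(s, x), rfl⟩).trans (le_max_left _ _)) (P, π) ⟨hP, trivial⟩

end UniformHitting

/-! ### Discounted and average values, then their infima over kernels. -/

section Values

open Filter Topology Matrix

lemma UncertaintySet.nonempty_kernels {ι S : Type*} {A : ι → Type*} [Fintype S]
    (U : UncertaintySet S A) : Nonempty U.kernels := by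
  choose f hf using U.factor_nonempty
  exact ⟨fun s a => ⟨f s a, U.factor_subset s a (hf s a)⟩, hf⟩

variable {ι S : Type*} {A : ι → Type*} [Fintype ι] [DecidableEq ι] [∀ i, Fintype (A i)]
variable {γ : ℝ} {r : S → JointAction A → ℝ}

lemma policyMean_mem_Icc (π : JointPolicy S A) (hr : ∀ s a, r s a ∈ Set.Icc (0 : ℝ) 1) (s : S) :
    policyMean π (fun x => r x.state x.action) s ∈ Set.Icc (0 : ℝ) 1 := by
  refine ⟨Finset.sum_nonneg fun a _ => mul_nonneg (actionProb_nonneg π s a) (hr s a).1, ?_⟩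
  rw [← sum_actionProb π s]
  exact Finset.sum_le_sum fun a _ => mul_le_of_le_one_right (actionProb_nonneg π s a) (hr s a).2

variable [Fintype S] [DecidableEq S]

lemma integrable_comp_eval (π : JointPolicy S A) (P : TransitionKernel S A) (s : S)
    (f : Step S A → ℝ) (n : ℕ) : Integrable (fun ω => f (ω n)) (trajectoryLaw π P s) :=
  integrable_eval_trajectoryLaw π P s n fun h => f (h ⟨n, Finset.mem_Iic.2 le_rfl⟩)

lemma integral_comp_eval (π : JointPolicy S A) (P : TransitionKernel S A) (s : S)
    (f : Step S A → ℝ) (n : ℕ) :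
    ∫ ω, f (ω n) ∂(trajectoryLaw π P s) = (transitionMatrix π P ^ n *ᵥ policyMean π f) s := by
  simpa using integral_prod_mul_trajectoryLaw π P s 1 n f

lemma hasSum_discountedValue (hγ : γ ∈ Set.Ico (0 : ℝ) 1) (hr : ∀ s a, r s a ∈ Set.Icc (0 : ℝ) 1)
    (π : JointPolicy S A) (P : TransitionKernel S A) (s : S) :
    HasSum (fun t => γ ^ t *
      (transitionMatrix π P ^ t *ᵥ policyMean π fun x => r x.state x.action) s)
      (discountedValue γ r π P s) := by
  have hint := integrable_comp_eval π P s fun x => r x.state x.action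
  have h := hasSum_integral_of_summable_integral_norm (μ := trajectoryLaw π P s)
    (F := fun t ω => γ ^ t * r (ω t).state (ω t).action) (fun t => (hint t).const_mul _) ?_
  · have heval := integral_comp_eval π P s fun x => r x.state x.action
    simp only [integral_const_mul, heval] at h
    exact h
  · refine Summable.of_nonneg_of_le (fun t => integral_nonneg fun ω => norm_nonneg _) (fun t => ?_)
      (summable_geometric_of_lt_one hγ.1 hγ.2)
    have hle : ∀ ω : ℕ → Step S A, ‖γ ^ t * r (ω t).state (ω t).action‖ ≤ γ ^ t := fun ω => by
      have h1 := hr (ω t).state (ω t).action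
      rw [Real.norm_of_nonneg (mul_nonneg (pow_nonneg hγ.1 t) h1.1)]
      exact mul_le_of_le_one_right (pow_nonneg hγ.1 t) h1.2
    calc _ ≤ ∫ _, γ ^ t ∂(trajectoryLaw π P s) :=
          integral_mono ((hint t).const_mul _).norm (integrable_const _) hle
      _ = γ ^ t := by simp

lemma discountedValue_eq (hγ : γ ∈ Set.Ico (0 : ℝ) 1) (hr : ∀ s a, r s a ∈ Set.Icc (0 : ℝ) 1)
    (π : JointPolicy S A) (P : TransitionKernel S A) :
    discountedValue γ r π P = policyMean π (fun x => r x.state x.action) +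
      γ • (transitionMatrix π P *ᵥ discountedValue γ r π P) := by
  ext s
  have h := hasSum_discountedValue hγ hr π P
  have h1 : HasSum (fun t => γ * (transitionMatrix π P *ᵥ fun s' => γ ^ t *
      (transitionMatrix π P ^ t *ᵥ policyMean π fun x => r x.state x.action) s') s)
      (γ * (transitionMatrix π P *ᵥ discountedValue γ r π P) s) :=
    (hasSum_sum (s := Finset.univ)
      fun s' _ => (h s').mul_left (transitionMatrix π P s s')).mul_left γ
  have h2 : ∀ t, γ * (transitionMatrix π P *ᵥ fun s' => γ ^ t *
      (transitionMatrix π P ^ t *ᵥ policyMean π fun x => r x.state x.action) s') s =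
      γ ^ (t + 1) *
        (transitionMatrix π P ^ (t + 1) *ᵥ policyMean π fun x => r x.state x.action) s :=
    fun t => by
      have h3 := congrFun (mulVec_smul (transitionMatrix π P) (γ ^ t)
        (transitionMatrix π P ^ t *ᵥ policyMean π fun x => r x.state x.action)) s
      rw [mulVec_mulVec, ← pow_succ'] at h3
      rw [pow_succ' γ, mul_assoc]
      exact congrArg (γ * ·) h3
  simp only [h2] at h1
  have h4 := (hasSum_nat_add_iff (f := fun t => γ ^ t *
    (transitionMatrix π P ^ t *ᵥ policyMean π fun x => r x.state x.action) s) 1).1 h1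
  refine (h s).unique ?_
  simpa [add_comm] using h4

lemma discountedValue_nonneg (hγ : 0 ≤ γ) (hr : ∀ s a, r s a ∈ Set.Icc (0 : ℝ) 1)
    (π : JointPolicy S A) (P : TransitionKernel S A) (s : S) : 0 ≤ discountedValue γ r π P s :=
  integral_nonneg fun _ => tsum_nonneg fun t => mul_nonneg (pow_nonneg hγ t) (hr _ _).1

lemma averageReward_eq (r : S → JointAction A → ℝ) (π : JointPolicy S A)
    (P : TransitionKernel S A) (s : S) :
    averageReward r π P s = liminf (fun n : ℕ => 1 / (n : ℝ) * ∑ t ∈ Finset.range n,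
      (transitionMatrix π P ^ t *ᵥ policyMean π fun x => r x.state x.action) s) atTop := by
  unfold averageReward
  congr 1
  ext n
  rw [integral_const_mul, integral_finsetSum _ fun t _ =>
    integrable_comp_eval π P s (fun x => r x.state x.action) t]
  congr 1
  exact Finset.sum_congr rfl fun t _ => integral_comp_eval π P s (fun x => r x.state x.action) t

lemma abs_averageReward_sub_le {P : TransitionKernel S A} {π : JointPolicy S A} {C : ℝ}
    (hC : IsHittingBound (transitionMatrix π P) C) (hC0 : 0 < C) (hγ : γ ∈ Set.Ico (0 : ℝ) 1)
    (hr : ∀ s a, r s a ∈ Set.Icc (0 : ℝ) 1) (s : S) :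
    |averageReward r π P s - (1 - γ) * discountedValue γ r π P s| ≤ (1 - γ) * (C * C) := by
  rw [averageReward_eq]
  exact abs_liminf_average_sub_le (transitionMatrix_mem_rowStochastic π P) hC hC0 hγ
    (policyMean_mem_Icc π hr) (discountedValue_eq hγ hr π P) s

/-- Nonnegativity of `g` bounds both families below, so that the real infima are genuine. -/
lemma abs_iInf_sub_mul_iInf_le {κ : Type*} [Nonempty κ] {f g : κ → ℝ} {a d : ℝ} (ha : 0 ≤ a)
    (hg : ∀ k, 0 ≤ g k) (h : ∀ k, |f k - a * g k| ≤ d) : |(⨅ k, f k) - a * ⨅ k, g k| ≤ d := by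
  have hag : ∀ k, 0 ≤ a * g k := fun k => mul_nonneg ha (hg k)
  have hf : BddBelow (Set.range f) := ⟨-d, by
    rintro _ ⟨k, rfl⟩
    linarith [(abs_le.1 (h k)).1, hag k]⟩
  have hg' : BddBelow (Set.range fun k => a * g k) := ⟨0, by rintro _ ⟨k, rfl⟩; exact hag k⟩
  rw [Real.mul_iInf_of_nonneg ha, abs_le]
  have h1 : (⨅ k, a * g k) - d ≤ ⨅ k, f k := le_ciInf fun k => by
    linarith [ciInf_le hg' k, (abs_le.1 (h k)).1]
  have h2 : (⨅ k, f k) - d ≤ ⨅ k, a * g k := le_ciInf fun k => by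
    linarith [ciInf_le hf k, (abs_le.1 (h k)).2]
  constructor <;> linarith

lemma abs_robustAverageReward_sub_le {U : UncertaintySet S A} {π : JointPolicy S A} {C : ℝ}
    (hC : ∀ P ∈ U.kernels, IsHittingBound (transitionMatrix π P) C) (hC0 : 0 < C)
    (hγ : γ ∈ Set.Ico (0 : ℝ) 1) (hr : ∀ s a, r s a ∈ Set.Icc (0 : ℝ) 1) (s : S) :
    |U.robustAverageReward r π s - (1 - γ) * U.robustDiscountedValue γ r π s| ≤
      (1 - γ) * (C * C) :=
  have := U.nonempty_kernels
  abs_iInf_sub_mul_iInf_le (sub_nonneg.2 hγ.2.le)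
    (fun P => discountedValue_nonneg hγ.1 hr π P.1 s)
    fun P => abs_averageReward_sub_le (hC P.1 P.2) hC0 hγ hr s

end Values

/-! ### Finiteness of the robust diameter. -/

section Diameter

open Matrix

variable {ι S : Type*} {A : ι → Type*} [DecidableEq S]

/-- The weight that vanishes exactly at the state `x`. -/
def avoid (x y : S) : ℝ := if y = x then 0 else 1

lemma avoid_nonneg (x y : S) : 0 ≤ avoid x y := by unfold avoid; split_ifs <;> norm_num

lemma avoid_le_one (x y : S) : avoid x y ≤ 1 := by unfold avoid; split_ifs <;> norm_num

/-- Tail-sum formula: the product is the indicator that `x` has not been visited up to time `t`. -/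
lemma hittingTime_le_tsum (x : S) (ω : ℕ → Step S A) :
    hittingTime x ω ≤
      ∑' t, ENNReal.ofReal (∏ i ∈ Finset.range (t + 1), avoid x (ω i).state) := by
  have hone : ∀ t, (∀ i ≤ t, (ω i).state ≠ x) →
      ENNReal.ofReal (∏ i ∈ Finset.range (t + 1), avoid x (ω i).state) = 1 := fun t ht => by
    rw [Finset.prod_eq_one fun i hi => show avoid x (ω i).state = 1 from
        if_neg (ht i (Nat.lt_succ_iff.1 (Finset.mem_range.1 hi))),
      ENNReal.ofReal_one]
  by_cases h : ∃ t, (ω t).state = x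
  · calc hittingTime x ω ≤ (Nat.find h : ℝ≥0∞) := iInf₂_le (Nat.find h) (Nat.find_spec h)
      _ = ∑ t ∈ Finset.range (Nat.find h), 1 := by simp
      _ = ∑ t ∈ Finset.range (Nat.find h),
          ENNReal.ofReal (∏ i ∈ Finset.range (t + 1), avoid x (ω i).state) :=
        Finset.sum_congr rfl fun t ht => (hone t fun i hi =>
          Nat.find_min h (hi.trans_lt (Finset.mem_range.1 ht))).symm
      _ ≤ _ := ENNReal.sum_le_tsum _
  · push Not at h
    simp_rw [hone _ fun i _ => h i]
    rw [ENNReal.tsum_const_eq_top_of_ne_zero one_ne_zero]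
    exact le_top

/-- The `t`-th term is the probability that `x` is not hit up to time `t`, so the sum is the
expectation of `min T n`. Truncation keeps it finite, and first-step analysis gives `w ≤ 1 + M w`.
-/
lemma sum_pow_diagonal_avoid_le [Fintype S] {M : Matrix S S ℝ} (hM : M ∈ rowStochastic ℝ S)
    {C : ℝ} (hC : IsHittingBound M C) (hC0 : 0 < C) (x : S) (n : ℕ) (s : S) :
    (∑ t ∈ Finset.range n, (diagonal (avoid x) * M) ^ t *ᵥ avoid x) s ≤ C * C := by
  set N := diagonal (avoid x) * M with hN
  have hNv : ∀ v s, (N *ᵥ v) s = avoid x s * (M *ᵥ v) s := fun v s => by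
    rw [hN, ← mulVec_mulVec, mulVec_diagonal]
  have hMnn : ∀ v : S → ℝ, (∀ s, 0 ≤ v s) → ∀ s, 0 ≤ (M *ᵥ v) s := fun v hv s =>
    le_mulVec_of_le hM hv s
  have hsucc : ∀ t, N ^ (t + 1) *ᵥ avoid x = N *ᵥ (N ^ t *ᵥ avoid x) := fun t => by
    rw [mulVec_mulVec, ← pow_succ']
  have hx : ∀ t, (N ^ t *ᵥ avoid x) x = 0 := fun t => by
    cases t with
    | zero => simp [avoid]
    | succ t => rw [hsucc, hNv]; simp [avoid]
  have hnn : ∀ t s, 0 ≤ (N ^ t *ᵥ avoid x) s := fun t => by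
    induction t with
    | zero => simpa using avoid_nonneg x
    | succ t ih =>
      intro s
      rw [hsucc, hNv]
      exact mul_nonneg (avoid_nonneg x s) (hMnn _ ih s)
  set w := ∑ t ∈ Finset.range n, N ^ t *ᵥ avoid x with hw
  have hw0 : ∀ s, 0 ≤ w s := fun s => by
    rw [hw, Finset.sum_apply]; exact Finset.sum_nonneg fun t _ => hnn t s
  refine le_sq_of_isHittingBound hM hC hC0 (x := x) ?_ hw0 (fun s => ?_) s
  · rw [hw, Finset.sum_apply]; exact Finset.sum_eq_zero fun t _ => hx t
  · have hrec : w + N ^ n *ᵥ avoid x = N *ᵥ w + avoid x := by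
      have h1 := Finset.sum_range_succ (fun t => N ^ t *ᵥ avoid x) n
      rw [Finset.sum_range_succ'] at h1
      simp only [hsucc, pow_zero, one_mulVec] at h1
      rw [← h1, hw, mulVec_sum]
    have h2 := congrFun hrec s
    simp only [Pi.add_apply, hNv] at h2
    linarith [hnn n s, avoid_le_one x s,
      mul_le_of_le_one_left (hMnn w hw0 s) (avoid_le_one x s)]

variable [Fintype ι] [DecidableEq ι] [Fintype S] [∀ i, Fintype (A i)]

lemma lintegral_hittingTime_le {P : TransitionKernel S A} {π : JointPolicy S A} {C : ℝ}
    (hC : IsHittingBound (transitionMatrix π P) C) (hC0 : 0 < C) (s x : S) :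
    ∫⁻ ω, hittingTime x ω ∂(trajectoryLaw π P s) ≤ ENNReal.ofReal (C * C) := by
  have hmean : policyMean π (fun _ : Step S A => (1 : ℝ)) = 1 := by
    ext s; simp [policyMean, sum_actionProb]
  have hint : ∀ t, Integrable (fun ω => ∏ i ∈ Finset.range (t + 1), avoid x (ω i).state)
      (trajectoryLaw π P s) := fun t => by
    have h := integrable_eval_trajectoryLaw π P s t
      fun h => ∏ i ∈ (Finset.range (t + 1)).attach, avoid x
        (h ⟨i.1, Finset.mem_Iic.2 (Nat.lt_succ_iff.1 (Finset.mem_range.1 i.2))⟩).state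
    refine h.congr (Filter.Eventually.of_forall fun ω => ?_)
    exact Finset.prod_attach (Finset.range (t + 1)) (fun i => avoid x (ω i).state)
  have hterm : ∀ t, ∫⁻ ω, ENNReal.ofReal (∏ i ∈ Finset.range (t + 1), avoid x (ω i).state)
      ∂(trajectoryLaw π P s) = ENNReal.ofReal
        (((diagonal (avoid x) * transitionMatrix π P) ^ t *ᵥ avoid x) s) := fun t => by
    have h := integral_prod_mul_trajectoryLaw π P s (avoid x) t fun _ => 1
    rw [hmean] at h
    simp only [mul_one] at h
    rw [← h, ofReal_integral_eq_lintegral_ofReal (hint t) (Filter.Eventually.of_forall fun ω =>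
      Finset.prod_nonneg fun i _ => avoid_nonneg x _)]
  calc _ ≤ ∫⁻ ω, ∑' t, ENNReal.ofReal (∏ i ∈ Finset.range (t + 1), avoid x (ω i).state)
        ∂(trajectoryLaw π P s) := lintegral_mono fun ω => hittingTime_le_tsum x ω
    _ = ∑' t, ENNReal.ofReal
        (((diagonal (avoid x) * transitionMatrix π P) ^ t *ᵥ avoid x) s) := by
      rw [lintegral_tsum fun t => (hint t).aestronglyMeasurable.aemeasurable.ennreal_ofReal]
      exact tsum_congr hterm
    _ ≤ ENNReal.ofReal (C * C) := by
      rw [ENNReal.tsum_eq_iSup_nat]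
      refine iSup_le fun n => ?_
      rw [← ENNReal.ofReal_sum_of_nonneg fun t _ => ?_]
      · refine ENNReal.ofReal_le_ofReal ?_
        have := sum_pow_diagonal_avoid_le (transitionMatrix_mem_rowStochastic π P) hC hC0 x n s
        rwa [Finset.sum_apply] at this
      · have h := integral_prod_mul_trajectoryLaw π P s (avoid x) t fun _ => 1
        rw [hmean, mul_one] at h
        rw [← h]
        exact integral_nonneg fun ω => mul_nonneg
          (Finset.prod_nonneg fun i _ => avoid_nonneg x _) zero_le_one

lemma robustDiameter_le [∀ i, Nonempty (A i)] {U : UncertaintySet S A} {C : ℝ} (hC0 : 0 < C)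
    (hC : ∀ P ∈ U.kernels, ∀ π : JointPolicy S A, IsHittingBound (transitionMatrix π P) C) :
    U.robustDiameter ≤ ENNReal.ofReal (C * C) := by
  classical
  let π : JointPolicy S A := fun i _ => stdSimplex.vertex (Classical.arbitrary (A i))
  exact iSup_le fun P => iSup_le fun s => iSup_le fun x =>
    iInf_le_of_le π (lintegral_hittingTime_le (hC P.1 P.2 π) hC0 s x)

end Diameter
end
end RobustMarkovGame

theorem mainTheorem7 {ι S : Type*} [Fintype ι] [DecidableEq ι] [Fintype S] [DecidableEq S]
    [Nonempty S] {A : ι → Type*} [∀ i, Fintype (A i)] [∀ i, Nonempty (A i)]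
    (U : RobustMarkovGame.UncertaintySet S A) (hU : U.IsRegular) :
    U.robustDiameter ≠ ⊤ ∧
    ∃ C : ℝ, 0 < C ∧
      ∀ r : ι → S → RobustMarkovGame.JointAction A → ℝ,
        (∀ i s a, r i s a ∈ Set.Icc (0 : ℝ) 1) →
        ∀ ε : ℝ, 0 < ε → ε ≤ U.robustDiameter.toReal →
          ∀ π : RobustMarkovGame.JointPolicy S A,
            U.IsDiscountedNash r (1 - ε / U.robustDiameter.toReal) ε π →
            U.IsAverageNash r (C * ε) π := by
  obtain ⟨C, hC0, hC⟩ := RobustMarkovGame.exists_isHittingBound hU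
  refine ⟨((RobustMarkovGame.robustDiameter_le hC0 hC).trans_lt ENNReal.ofReal_lt_top).ne,
    -- If the diameter is `0`, the quotient is `0` by convention and no `ε` is admissible.
    1 + 2 * (C * C) / U.robustDiameter.toReal, by positivity, ?_⟩
  intro r hr ε hε hεD π hπ i μ s
  set D := U.robustDiameter.toReal
  have hD : 0 < D := hε.trans_le hεD
  have hq0 : 0 ≤ ε / D := by positivity
  have hq1 : ε / D ≤ 1 := (div_le_one hD).2 hεD
  have hγ : 1 - ε / D ∈ Set.Ico (0 : ℝ) 1 := ⟨by linarith, by linarith [div_pos hε hD]⟩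
  have h1 := RobustMarkovGame.abs_robustAverageReward_sub_le
    (fun P hP => hC P hP (Function.update π i μ)) hC0 hγ (hr i) s
  have h2 := RobustMarkovGame.abs_robustAverageReward_sub_le
    (fun P hP => hC P hP π) hC0 hγ (hr i) s
  rw [sub_sub_cancel] at h1 h2
  -- The Nash inequality scaled by `1 - γ = ε / D`; its slack `ε / D * ε` is at most `ε`.
  have h3 := mul_le_mul_of_nonneg_left (hπ i μ s) hq0
  have h4 : (1 + 2 * (C * C) / D) * ε = ε + 2 * (ε / D * (C * C)) := by ring
  rw [h4]
  linarith [(abs_le.1 h1).2, (abs_le.1 h2).1, mul_le_mul_of_nonneg_right hq1 hε.le]
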